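/- **Setting.** Fix integers $k,m\ge 1$. There are $n$ items $1,\dots,n$ with $n>m$ and $n\ge km$, and successive requests are i.i.d., item $i$ being requested with probability $p_i$, where $p_1\ge p_2\ge\dots\ge p_n>0$ and $\sum_i p_i=1$ (IRM). The $k$-LRU algorithm manages $k$ ordered caches of size $m$ (caches $1,\dots,k-1$ are meta-caches, cache $k$ is the real one). When item $i$ is requested: in every cache that contains $i$, it moves to the first position; in every cache $l$ that does not contain $i$ and such that $l=1$ or cache $l-1$ contained $i$ before the request, $i$ is inserted in the first position, the other items move back by one and the last item is evicted; the other caches do not change. This is a Markov chain on the set $\mathcal S$ of states $\boldsymbol x=(\boldsymbol x_1,\dots,\boldsymbol x_k)$, each $\boldsymbol x_l$ being a vector of $m$ distinct items. Its mixing time $t_{\rm mix}$ is the least number $t$ of requests such that, from every initial state in $\mathcal S$, the law after $t$ requests is within total variation distance $\tfrac12$ of the stationary distribution. **Sample paths.** For a state $\boldsymbol x$ let $h(y)$ be the highest cache containing the item $y$ ($h(y)=0$ if there is none). A sample path for $\boldsymbol x$ is a finite request sequence leading from empty caches to $\boldsymbol x$; its *fixed* requests are the final $h(y)$ requests for each item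 $y$, and the sequence $\hat{\boldsymbol x}$ of its fixed requests is its arrangement. The sample paths for $\boldsymbol x$ with a given arrangement form a class $\Lambda(\hat{\boldsymbol x})$. For a path $\gamma$, $\Xi(\gamma)$ is the product of the probabilities of the non-fixed requests after the first fixed one, and the weight of a class is the sum of $\Xi$ over its paths, paths being identified if they agree from the first fixed request on. $\Lambda^{\max}(\boldsymbol x)$ denotes a class of maximal weight for $\boldsymbol x$, and $\chi^{\Lambda}_{(\delta,\delta+1)}$ is the set of items that are requested between the $\delta$-th and the $(\delta+1)$-th fixed request on some path of the class $\Lambda$. Put $$s^*=\max_{\boldsymbol x\in\mathcal S,\ \delta}\ \sum_{j\in\chi^{\Lambda^{\max}(\boldsymbol x)}_{(\delta,\delta+1)}}p_j ,$$ the maximum being over all states that have a sample path, all classes of maximal weight and all $\delta$ from $1$ to the length of the arrangement minus one (and $s^*=0$ if there is no such $\delta$). Write $D=\prod_{i=1}^k\Big(\prod_{l=1+(i-1)m}^{im}p_{n-l+1}\Big)^{k-i+1}$ and $$B(s)=\frac{n^{4km+4(m-1)\left[\frac{k(k+1)m}{2}-1\right]}}{D^2\,p_n^2}\left(\Big(\prod_{j=1}^m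 p_j\Big)^k\Big(\frac1{1-s}\Big)^{\frac{k(k+1)m}{2}-1}\right)^4\ln\frac1D .$$ **Theorem.** There is a constant $C>0$ depending only on $k$ and $m$ such that, for all $n$ and $p$ as above, $s^*<1$, the chain has exactly one stationary distribution, its mixing time $t_{\rm mix}$ is finite, and $$t_{\rm mix}\le C\,B(s^*)\qquad\text{and}\qquad t_{\rm mix}\le C\,B\Big(\sum_{j=1}^{m-1}p_j\Big).$$ In particular $t_{\rm mix}^{k\text{-LRU}}=O(B(s^*))$. -/

import Mathlib

namespace KLRU

/-! ### The `k`-LRU algorithm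

The items are the elements of `Fin n`. The contents of the `k` caches are given by `k` lists, most
recently used item first; the caches of index `l < k - 1` are the meta-caches and the last one is
the real cache. -/

/-- Contents of the `k` caches, possibly not yet full. -/
abbrev Config (n k : ℕ) : Type := Fin k → List (Fin n)

/-- Effect of a request for the item `i` when every cache has size `m`. In each cache that holds
`i`, the item moves to the front. In each cache that does not hold `i`, but whose predecessor holds
it before the request, `i` is inserted at the front and the last item is evicted if the cache
overflows. The first cache has no predecessor and admits every requested item. All the other caches
are unchanged. -/
def step {n k : ℕ} (m : ℕ) (i : Fin n) (c : Config n k) : Config n k := fun l =>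
  open Classical in
  if i ∈ c l ∨ ∀ l' : Fin k, l'.val + 1 = l.val → i ∈ c l' then
    (i :: (c l).erase i).take m
  else c l

/-- Contents of the caches after the sequence of requests `γ` (first request first). -/
def run {n k : ℕ} (m : ℕ) (γ : List (Fin n)) (c : Config n k) : Config n k :=
  γ.foldl (fun c i => step m i c) c

/-- The state space: each of the `k` caches holds a vector of `m` distinct items. -/
abbrev State (n k m : ℕ) : Type := Fin k → (Fin m ↪ Fin n)

/-- The lists of items held by the caches in a state. -/
def State.toConfig {n k m : ℕ} (x : State n k m) : Config n k := fun l => List.ofFn (x l)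

open Classical in
/-- Transition matrix of `k`-LRU when successive requests are independent and item `i` is requested
with probability `p i`. -/
noncomputable def transition {n : ℕ} (k m : ℕ) (p : Fin n → ℝ) :
    Matrix (State n k m) (State n k m) ℝ :=
  fun x y => ∑ i, if step m i x.toConfig = y.toConfig then p i else 0

/-! ### Stationary distributions and mixing time -/

/-- `π` is a stationary distribution of the transition matrix `P`. -/
def IsStationary {S : Type*} [Fintype S] (P : Matrix S S ℝ) (π : S → ℝ) : Prop :=
  (∀ x, 0 ≤ π x) ∧ ∑ x, π x = 1 ∧ ∀ y, ∑ x, π x * P x y = π y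

/-- Total variation distance of two probability vectors on a finite set. -/
noncomputable def tvDist {S : Type*} [Fintype S] (μ ν : S → ℝ) : ℝ := (∑ x, |μ x - ν x|) / 2

open Classical in
/-- `t` is the mixing time `t_mix(ε)` of `P` relative to `π`: the smallest number of steps after
which the law of the chain is within `ε` of `π` in total variation, for every initial state. -/
def IsMixingTime {S : Type*} [Fintype S] (P : Matrix S S ℝ) (π : S → ℝ) (ε : ℝ) (t : ℕ) : Prop :=
  IsLeast {s : ℕ | ∀ x, tvDist ((P ^ s) x) π ≤ ε} t

/-! ### Sample paths, their arrangements and classes -/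

open Classical in
/-- `h(y)`: the highest level (counted from `1`) at which `y` is present in `c`; it is `0` if `y` is
in no cache. -/
noncomputable def height {n k : ℕ} (c : Config n k) (y : Fin n) : ℕ :=
  Finset.univ.sup fun l : Fin k => if y ∈ c l then l.val + 1 else 0

/-- A request for `i` that is followed by the requests `β` is fixed (relative to the final contents
`c`) if it is one of the final `h(i)` requests for `i`. -/
def IsFixed {n k : ℕ} (c : Config n k) (i : Fin n) (β : List (Fin n)) : Prop :=
  (i :: β).count i ≤ height c i

open Classical in
/-- The sequence `x̂` of the fixed requests of `γ`, i.e. of the final `h(y)` requests for each item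
`y` present in `c`, in the order in which they occur in `γ`. -/
noncomputable def arrangement {n k : ℕ} (c : Config n k) : List (Fin n) → List (Fin n)
  | [] => []
  | i :: β => if IsFixed c i β then i :: arrangement c β else arrangement c β

open Classical in
/-- Product of the probabilities of the requests of `γ` that are not fixed. -/
noncomputable def otherProb {n k : ℕ} (p : Fin n → ℝ) (c : Config n k) : List (Fin n) → ℝ
  | [] => 1
  | i :: β => (if IsFixed c i β then 1 else p i) * otherProb p c β

/-- The class `Λ(x̂)` of sample paths: the request sequences that lead from empty caches to `c` and
whose fixed requests form the arrangement `a`. -/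
def pathClass {n k : ℕ} (m : ℕ) (c : Config n k) (a : List (Fin n)) : Set (List (Fin n)) :=
  {γ | run m γ (fun _ => []) = c ∧ arrangement c γ = a}

/-- `Υ(x)`: the arrangements whose class of sample paths is nonempty. -/
def validArrangements {n k : ℕ} (m : ℕ) (c : Config n k) : Set (List (Fin n)) :=
  {a | (pathClass m c a).Nonempty}

/-- The sample paths of a class, from their first fixed request on. The requests before the first
fixed one are arbitrary up to consistency and carry no weight. -/
def pathTails {n k : ℕ} (m : ℕ) (c : Config n k) (a : List (Fin n)) : Set (List (Fin n)) :=
  {τ | (∃ α, α ++ τ ∈ pathClass m c a) ∧ ∃ i β, τ = i :: β ∧ IsFixed c i β ∧ arrangement c τ = a}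

/-- The weight `∑ Ξ(γ)` of the class of the arrangement `a`. -/
noncomputable def classWeight {n k : ℕ} (m : ℕ) (p : Fin n → ℝ) (c : Config n k)
    (a : List (Fin n)) : ENNReal :=
  ∑' τ : pathTails m c a, ENNReal.ofReal (otherProb p c τ.1)

/-- `Λ(a)` is a class of sample paths of maximal weight among those that lead to `c`. -/
def IsMaxClass {n k : ℕ} (m : ℕ) (p : Fin n → ℝ) (c : Config n k) (a : List (Fin n)) : Prop :=
  a ∈ validArrangements m c ∧
    ∀ b ∈ validArrangements m c, classWeight m p c b ≤ classWeight m p c a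

/-- `χ_{(δ, δ+1)}`: the items that can be requested between the `δ`-th and the `(δ+1)`-th fixed
request (counted from `1`) on a sample path of the class of `a`. In the decomposition below, the
request for `j` is not fixed and exactly `δ` of the fixed requests precede it. -/
def gapItems {n k : ℕ} (m : ℕ) (c : Config n k) (a : List (Fin n)) (δ : ℕ) : Set (Fin n) :=
  {j | ∃ α β : List (Fin n), α ++ j :: β ∈ pathClass m c a ∧ ¬ IsFixed c j β ∧
    (arrangement c β).length + δ = a.length}

open Classical in
/-- `max_{x, δ} ∑_{j ∈ χ_{(δ, δ+1)}} p_j` over the states `x`, the classes of maximal weight leading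
to `x` and the pairs of consecutive fixed requests. It is `0` if there is no such pair. -/
noncomputable def maxGapProb {n : ℕ} (k m : ℕ) (p : Fin n → ℝ) : ℝ :=
  sSup {s | ∃ (x : State n k m) (a : List (Fin n)) (δ : ℕ),
    IsMaxClass m p x.toConfig a ∧ 1 ≤ δ ∧ δ < a.length ∧
      s = ∑ j, if j ∈ gapItems m x.toConfig a δ then p j else 0}

/-! ### The bound -/

/-- `p_j` with the items numbered `1, …, n`. -/
def prob {n : ℕ} (p : Fin n → ℝ) (j : ℕ) : ℝ :=
  if h : 1 ≤ j ∧ j ≤ n then p ⟨j - 1, by omega⟩ else 0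

/-- `∏_{i=1}^k (∏_{l=1+(i-1)m}^{im} p_{n-l+1})^{k-i+1}`. -/
def leastProd {n : ℕ} (k m : ℕ) (p : Fin n → ℝ) : ℝ :=
  ∏ i ∈ Finset.Icc 1 k,
    (∏ l ∈ Finset.Icc (1 + (i - 1) * m) (i * m), prob p (n - l + 1)) ^ (k - i + 1)

/-- The expression inside the `O(·)`, with `s` in place of `max_{x, δ} ∑_{j ∈ χ_{(δ, δ+1)}} p_j`. -/
noncomputable def mixingBound {n : ℕ} (k m : ℕ) (p : Fin n → ℝ) (s : ℝ) : ℝ :=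
  (n : ℝ) ^ (4 * k * m + 4 * (m - 1) * (k * (k + 1) * m / 2 - 1)) /
      (leastProd k m p ^ 2 * prob p n ^ 2) *
    ((∏ j ∈ Finset.Icc 1 m, prob p j) ^ k * (1 / (1 - s)) ^ (k * (k + 1) * m / 2 - 1)) ^ 4 *
    Real.log (1 / leastProd k m p)

end KLRU

namespace KLRU

/-! ### Dynamics of the caches -/

section Dynamics

variable {n k m : ℕ}

/-! The chain satisfies a Doeblin condition with an explicit constant. Requesting each of the `m`
most popular items `k` times in a row drives every state to one and the same state
(`run_coalesces`). So after `km` requests all initial states share a target of probability at least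
`q = (p_1 ⋯ p_m)^k` (`exists_minorizing_state`). Contraction of mass-zero vectors then gives
uniqueness of the stationary distribution and a mixing time of at most `km⌈1/q⌉`
(`exists_isMixingTime_of_minorized`).

It remains to see that `B(s)` dominates `(log 2)/q` whenever `p_1 + ⋯ + p_{m-1} ≤ s < 1`
(`le_mixingBound`). Here `1 - s ≤ n p_m` and `1 ≤ n p_1`, so `n^{km}` times the bracket raised to
the fourth power in `B` is at least `1`. Moreover `D ≤ q` and `D ≤ 1/2`.

Sample paths enter only to show that `s*` lies in this range. It is below `1` because the item of
the first fixed request never occurs in a gap (`head_notMem_gapItems`). It is at least `p_1 + ⋯ +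
p_{m-1}` because of a state with equal caches, chosen so that those items fit in the first gap of
every class, hence of a maximal one (`sum_prob_top_le_maxGapProb`). -/

theorem run_cons (i : Fin n) (w : List (Fin n)) (c : Config n k) :
    run m (i :: w) c = run m w (step m i c) := rfl

theorem run_append (v w : List (Fin n)) (c : Config n k) :
    run m (v ++ w) c = run m w (run m v c) := List.foldl_append

theorem step_of_admits {i : Fin n} {c : Config n k} {l : Fin k}
    (h : i ∈ c l ∨ ∀ l' : Fin k, l'.val + 1 = l.val → i ∈ c l') :
    step m i c l = (i :: (c l).erase i).take m := if_pos h

theorem step_of_not_admits {i : Fin n} {c : Config n k} {l : Fin k}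
    (h : ¬ (i ∈ c l ∨ ∀ l' : Fin k, l'.val + 1 = l.val → i ∈ c l')) :
    step m i c l = c l := if_neg h

/-- The list obtained from `L` by moving the items of `w` successively to the front. -/
def moveToFront (w L : List (Fin n)) : List (Fin n) :=
  w.foldl (fun L i => i :: L.erase i) L

theorem moveToFront_cons (i : Fin n) (w L : List (Fin n)) :
    moveToFront (i :: w) L = moveToFront w (i :: L.erase i) := rfl

theorem nodup_cons_erase {L : List (Fin n)} (hL : L.Nodup) (i : Fin n) :
    (i :: L.erase i).Nodup :=
  List.nodup_cons.2 ⟨hL.not_mem_erase, hL.erase i⟩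

/-- Moving items to the front sorts them by their last occurrence. -/
theorem moveToFront_eq (w : List (Fin n)) {L : List (Fin n)} (hL : L.Nodup) :
    moveToFront w L = w.dedup.reverse ++ L.filter (· ∉ w) := by
  induction w generalizing L with
  | nil => simp [moveToFront]
  | cons i w ih =>
    rw [moveToFront_cons, ih (nodup_cons_erase hL i)]
    have herase : L.erase i = L.filter (· ≠ i) := by
      rw [hL.erase_eq_filter]; congr 1; funext j; simp [bne, Bool.beq_eq_decide_eq]
    by_cases hi : i ∈ w
    · rw [List.dedup_cons_of_mem hi, List.filter_cons_of_neg (by simpa using hi), herase,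
        List.filter_filter]
      congr 1
      apply List.filter_congr
      intro j _
      by_cases hj : j = i <;> simp [hj, hi]
    · rw [List.dedup_cons_of_notMem hi, List.filter_cons_of_pos (by simpa using hi), herase,
        List.filter_filter]
      simp only [List.reverse_cons, List.append_assoc, List.singleton_append]
      congr 2
      apply List.filter_congr
      intro j _
      by_cases hj : j = i <;> simp [hj]

theorem take_erase_take (L : List (Fin n)) (i : Fin n) (r : ℕ) :
    ((L.take (r + 1)).erase i).take r = (L.erase i).take r := by
  induction L generalizing r with
  | nil => simp
  | cons j L ih =>
    rw [List.take_succ_cons]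
    by_cases hj : j = i
    · subst hj; simp
    · rw [List.erase_cons_tail (by simpa using hj), List.erase_cons_tail (by simpa using hj)]
      cases r with
      | zero => simp
      | succ r => rw [List.take_succ_cons, List.take_succ_cons, ih]

/-- Moving an item to the front shifts nothing from beyond position `m` into the first `m`.
Truncation can therefore be postponed to the end of a request sequence. -/
theorem take_cons_erase_take (L : List (Fin n)) (i : Fin n) :
    (i :: (L.take m).erase i).take m = (i :: L.erase i).take m := by
  cases m with
  | zero => simp
  | succ r => rw [List.take_succ_cons, List.take_succ_cons, take_erase_take]

theorem foldl_take_cons_erase (w L : List (Fin n)) :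
    w.foldl (fun L i => (i :: L.erase i).take m) (L.take m) = (moveToFront w L).take m := by
  induction w generalizing L with
  | nil => rfl
  | cons i w ih => rw [List.foldl_cons, take_cons_erase_take, ih, moveToFront_cons]

/-- The first cache holds the most recently requested items. -/
theorem run_first (w : List (Fin n)) {c : Config n k} {l : Fin k} (hl : l.val = 0)
    (hc : (c l).length ≤ m) : run m w c l = (moveToFront w (c l)).take m := by
  rw [← foldl_take_cons_erase, List.take_of_length_le hc]
  clear hc
  induction w generalizing c with
  | nil => rfl
  | cons i w ih =>
    rw [run_cons, ih, step_of_admits (Or.inr fun l' h => by omega)]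
    rfl

/-- A cache that holds all the requested items is only reordered. -/
theorem run_of_forall_mem (w : List (Fin n)) {c : Config n k} {l : Fin k}
    (hw : ∀ i ∈ w, i ∈ c l) (hc : (c l).length ≤ m) :
    run m w c l = moveToFront w (c l) := by
  induction w generalizing c with
  | nil => rfl
  | cons i w ih =>
    have hi : i ∈ c l := hw i List.mem_cons_self
    have hlen : (i :: (c l).erase i).length = (c l).length := by
      rw [List.length_cons, List.length_erase_of_mem hi]
      have := List.length_pos_of_mem hi
      omega
    have hs : step m i c l = i :: (c l).erase i := by
      rw [step_of_admits (Or.inl hi), List.take_of_length_le (hlen ▸ hc)]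
    rw [run_cons, ih _ (by rw [hs, hlen]; exact hc), hs, moveToFront_cons]
    intro j hj
    rw [hs, List.mem_cons]
    by_cases hji : j = i
    · exact Or.inl hji
    · exact Or.inr ((List.mem_erase_of_ne hji).2 (hw j (List.mem_cons_of_mem _ hj)))

theorem mem_take_cons (hm : 1 ≤ m) (i : Fin n) (L : List (Fin n)) : i ∈ (i :: L).take m := by
  obtain ⟨r, rfl⟩ := Nat.exists_eq_add_of_le' hm
  simp

/-- Each request lifts `y` by at least one cache, and once `y` is at the front of a cache further
requests for it change nothing there. A cache not yet updated after `r` requests thus has index at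
least `r`. -/
theorem run_replicate_aux (hm : 1 ≤ m) (y : Fin n) (c : Config n k) (r : ℕ) (l : Fin k) :
    run m (List.replicate r y) c l = (y :: (c l).erase y).take m ∨
      (r ≤ l.val ∧ run m (List.replicate r y) c l = c l) := by
  induction r generalizing l with
  | zero => exact Or.inr ⟨Nat.zero_le _, rfl⟩
  | succ r ih =>
    rw [List.replicate_succ', run_append]
    set c' := run m (List.replicate r y) c with hc'
    change step m y c' l = _ ∨ _ ∧ step m y c' l = _
    rcases ih l with h | ⟨hr, h⟩
    · left
      rw [step_of_admits (Or.inl (h ▸ mem_take_cons hm _ _)), h, take_cons_erase_take]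
      simp
    · by_cases ha : y ∈ c' l ∨ ∀ l' : Fin k, l'.val + 1 = l.val → y ∈ c' l'
      · left; rw [step_of_admits ha, h]
      · right
        refine ⟨?_, by rw [step_of_not_admits ha, h]⟩
        push Not at ha
        obtain ⟨-, l', hl', hy⟩ := ha
        rcases ih l' with h' | ⟨hr', -⟩
        · exact absurd (h' ▸ mem_take_cons hm _ _) hy
        · omega

/-- After `k` consecutive requests, an item is at the front of every cache. -/
theorem run_replicate (hm : 1 ≤ m) (y : Fin n) (c : Config n k) (l : Fin k) :
    run m (List.replicate k y) c l = (y :: (c l).erase y).take m := by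
  rcases run_replicate_aux hm y c k l with h | ⟨h, -⟩
  · exact h
  · omega

/-- A block of `k` equal requests acts on every cache as one plain LRU request, so along such blocks
the caches no longer interact. -/
theorem run_flatMap_replicate (hm : 1 ≤ m) (w : List (Fin n)) {c : Config n k} (l : Fin k)
    (hc : (c l).length ≤ m) :
    run m (w.flatMap (List.replicate k)) c l = (moveToFront w (c l)).take m := by
  rw [← foldl_take_cons_erase, List.take_of_length_le hc]
  clear hc
  induction w generalizing c with
  | nil => rfl
  | cons i w ih => rw [List.flatMap_cons, run_append, ih, run_replicate hm, List.foldl_cons]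

/-- Requesting each of `m` distinct items `k` times in a row makes all the caches equal. -/
theorem run_coalesces (hm : 1 ≤ m) {w : List (Fin n)} (hw : w.Nodup) (hlen : w.length = m)
    {c : Config n k} (l : Fin k) (hc : (c l).length ≤ m) (hn : (c l).Nodup) :
    run m (w.flatMap (List.replicate k)) c l = w.reverse := by
  rw [run_flatMap_replicate hm w l hc, moveToFront_eq w hn, hw.dedup,
    List.take_append_of_le_length (by simp [hlen]), List.take_of_length_le (by simp [hlen])]

theorem length_step {i : Fin n} {c : Config n k} {l : Fin k} (h : (c l).length = m) :
    (step m i c l).length = m := by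
  by_cases ha : i ∈ c l ∨ ∀ l' : Fin k, l'.val + 1 = l.val → i ∈ c l'
  · rw [step_of_admits ha, List.length_take, List.length_cons, List.length_erase]
    split_ifs <;> omega
  · rw [step_of_not_admits ha, h]

theorem nodup_step {i : Fin n} {c : Config n k} {l : Fin k} (h : (c l).Nodup) :
    (step m i c l).Nodup := by
  by_cases ha : i ∈ c l ∨ ∀ l' : Fin k, l'.val + 1 = l.val → i ∈ c l'
  · rw [step_of_admits ha]
    exact (nodup_cons_erase h i).sublist (List.take_sublist _ _)
  · rwa [step_of_not_admits ha]

/-- An item needs at least `l` requests to reach the `l`-th cache. -/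
theorem lt_count_of_mem_run (w : List (Fin n)) {i : Fin n} {l : Fin k}
    (h : i ∈ run m w (fun _ => []) l) : l.val < w.count i := by
  induction w using List.reverseRecOn generalizing l with
  | nil => simp [run] at h
  | append_singleton w j ih =>
    rw [run_append] at h
    set c := run m w (fun _ : Fin k => []) with hc
    change i ∈ step m j c l at h
    rw [List.count_append]
    by_cases ha : j ∈ c l ∨ ∀ l' : Fin k, l'.val + 1 = l.val → j ∈ c l'
    · rw [step_of_admits ha] at h
      rcases List.mem_cons.1 (List.mem_of_mem_take h) with rfl | h
      · simp only [List.count_singleton_self]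
        rcases ha with ha | ha
        · have := ih ha; omega
        · rcases Nat.eq_zero_or_pos l.val with h0 | h0
          · omega
          · have := ih (ha ⟨l.val - 1, by omega⟩ (by simp; omega))
            simp at this; omega
      · have := ih (List.mem_of_mem_erase h); omega
    · rw [step_of_not_admits ha] at h
      have := ih h; omega

end Dynamics

section States

variable {n k m : ℕ}

theorem exists_embedding_ofFn {L : List (Fin n)} (h : L.Nodup) (hlen : L.length = m) :
    ∃ e : Fin m ↪ Fin n, List.ofFn e = L := by
  subst hlen
  exact ⟨⟨L.get, List.nodup_iff_injective_get.1 h⟩, List.ofFn_get L⟩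

theorem State.toConfig_injective :
    Function.Injective (State.toConfig : State n k m → Config n k) := by
  intro x y h
  funext l
  exact DFunLike.coe_injective (List.ofFn_injective (congrFun h l))

theorem State.length_toConfig (x : State n k m) (l : Fin k) : (x.toConfig l).length = m := by
  simp [State.toConfig]

theorem State.nodup_toConfig (x : State n k m) (l : Fin k) : (x.toConfig l).Nodup :=
  List.nodup_ofFn.2 (x l).injective

theorem exists_toConfig_eq {c : Config n k} (hn : ∀ l, (c l).Nodup)
    (hlen : ∀ l, (c l).length = m) : ∃ x : State n k m, x.toConfig = c := by
  choose e he using fun l => exists_embedding_ofFn (hn l) (hlen l)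
  exact ⟨e, funext he⟩

theorem exists_toConfig_eq_step (i : Fin n) (x : State n k m) :
    ∃ y : State n k m, y.toConfig = step m i x.toConfig :=
  exists_toConfig_eq (fun l => nodup_step (x.nodup_toConfig l))
    (fun l => length_step (x.length_toConfig l))

end States

/-! ### Minorized finite Markov chains -/

section Minorization

open Matrix

variable {S : Type*} [Fintype S]

theorem isStationary_iff {P : Matrix S S ℝ} {π : S → ℝ} :
    IsStationary P π ↔ (∀ x, 0 ≤ π x) ∧ ∑ x, π x = 1 ∧ π ᵥ* P = π := by
  simp only [IsStationary, funext_iff, vecMul, dotProduct]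

variable [DecidableEq S]

theorem sum_vecMul {Q : Matrix S S ℝ} (hQ : Q ∈ rowStochastic ℝ S) (v : S → ℝ) :
    ∑ y, (v ᵥ* Q) y = ∑ x, v x := by
  simp only [vecMul, dotProduct]
  rw [Finset.sum_comm]
  simp only [← Finset.mul_sum, sum_row_of_mem_rowStochastic hQ, mul_one]

/-- A stochastic matrix with a column bounded below by `q` contracts vectors of total mass `0`. -/
theorem sum_abs_vecMul_le {Q : Matrix S S ℝ} (hQ : Q ∈ rowStochastic ℝ S) {z : S} {q : ℝ}
    (hz : ∀ x, q ≤ Q x z) {v : S → ℝ} (hv : ∑ x, v x = 0) :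
    ∑ y, |(v ᵥ* Q) y| ≤ (1 - q) * ∑ x, |v x| := by
  -- Removing `q` from column `z` does not change `v ᵥ* Q`, as `v` has mass `0`. The remainder is
  -- nonnegative with row sums `1 - q`.
  set R : S → S → ℝ := fun x y => Q x y - if y = z then q else 0 with hR
  have hR0 : ∀ x y, 0 ≤ R x y := by
    intro x y
    simp only [hR]
    split_ifs with h
    · subst h; linarith [hz x]
    · linarith [nonneg_of_mem_rowStochastic hQ (i := x) (j := y)]
  have hRsum : ∀ x, ∑ y, R x y = 1 - q := by
    intro x
    simp [hR, Finset.sum_sub_distrib, sum_row_of_mem_rowStochastic hQ]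
  have hvR : ∀ y, (v ᵥ* Q) y = ∑ x, v x * R x y := by
    intro y
    simp only [vecMul, dotProduct, hR, mul_sub, Finset.sum_sub_distrib, ← Finset.sum_mul, hv,
      zero_mul, sub_zero]
  calc ∑ y, |(v ᵥ* Q) y| ≤ ∑ y, ∑ x, |v x| * R x y := by
        refine Finset.sum_le_sum fun y _ => ?_
        rw [hvR]
        refine (Finset.abs_sum_le_sum_abs _ _).trans (Finset.sum_le_sum fun x _ => ?_)
        rw [abs_mul, abs_of_nonneg (hR0 x y)]
    _ = (1 - q) * ∑ x, |v x| := by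
        rw [Finset.sum_comm, Finset.mul_sum]
        refine Finset.sum_congr rfl fun x _ => ?_
        rw [← Finset.mul_sum, hRsum, mul_comm]

theorem sum_abs_vecMul_pow_le {Q : Matrix S S ℝ} (hQ : Q ∈ rowStochastic ℝ S) {z : S} {q : ℝ}
    (hz : ∀ x, q ≤ Q x z) {v : S → ℝ} (hv : ∑ x, v x = 0) (hq : q ≤ 1) (N : ℕ) :
    ∑ y, |(v ᵥ* Q ^ N) y| ≤ (1 - q) ^ N * ∑ x, |v x| := by
  induction N with
  | zero => simp
  | succ N ih =>
    rw [pow_succ, ← vecMul_vecMul]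
    refine (sum_abs_vecMul_le hQ hz (by rw [sum_vecMul (pow_mem hQ N), hv])).trans ?_
    rw [pow_succ', mul_assoc]
    exact mul_le_mul_of_nonneg_left ih (by linarith)

theorem vecMul_pow_of_fixed {P : Matrix S S ℝ} {v : S → ℝ} (h : v ᵥ* P = v) (t : ℕ) :
    v ᵥ* P ^ t = v := by
  induction t with
  | zero => simp
  | succ t ih => rw [pow_succ, ← vecMul_vecMul, ih, h]

/-- `P - 1` kills the constant vector, hence is singular and has a left null vector `v`. The vector
`|v|` satisfies `|v| ≤ |v| P` entrywise, and both sides have the same total mass, so equality holds.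
Normalizing gives the distribution. -/
theorem exists_isStationary [Nonempty S] {P : Matrix S S ℝ} (hP : P ∈ rowStochastic ℝ S) :
    ∃ π, IsStationary P π := by
  have hdet : (P - 1).det = 0 := by
    rw [← exists_mulVec_eq_zero_iff]
    refine ⟨1, one_ne_zero, ?_⟩
    rw [sub_mulVec, (mem_rowStochastic.1 hP).2, one_mulVec, sub_self]
  obtain ⟨v, hv0, hv⟩ := exists_vecMul_eq_zero_iff.2 hdet
  rw [vecMul_sub, vecMul_one, sub_eq_zero] at hv
  set u : S → ℝ := fun x => |v x| with hu
  have hle : ∀ y, u y ≤ (u ᵥ* P) y := by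
    intro y
    have : u y = |(v ᵥ* P) y| := by rw [hv]
    rw [this]
    refine (Finset.abs_sum_le_sum_abs _ _).trans (Finset.sum_le_sum fun x _ => ?_)
    rw [abs_mul, abs_of_nonneg (nonneg_of_mem_rowStochastic hP)]
  have hfix : u ᵥ* P = u := by
    funext y
    exact ((Finset.sum_eq_sum_iff_of_le fun y _ => hle y).1 (sum_vecMul hP u).symm y
      (Finset.mem_univ y)).symm
  have hpos : 0 < ∑ x, u x := by
    obtain ⟨x, hx⟩ := Function.ne_iff.1 hv0
    exact Finset.sum_pos' (fun x _ => abs_nonneg _) ⟨x, Finset.mem_univ x, abs_pos.2 hx⟩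
  refine ⟨(∑ x, u x)⁻¹ • u, isStationary_iff.2 ⟨fun x => ?_, ?_, ?_⟩⟩
  · exact mul_nonneg (inv_nonneg.2 hpos.le) (abs_nonneg _)
  · simp only [Pi.smul_apply, smul_eq_mul, ← Finset.mul_sum]
    exact inv_mul_cancel₀ hpos.ne'
  · rw [smul_vecMul, hfix]

/-- If `P ^ T` has a column bounded below by `q > 0`, then `P` has a unique stationary distribution
and mixes within `T * ⌈1 / q⌉` steps. -/
theorem exists_isMixingTime_of_minorized [Nonempty S] {P : Matrix S S ℝ}
    (hP : P ∈ rowStochastic ℝ S) {T : ℕ} {z : S} {q : ℝ} (hq : 0 < q)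
    (hz : ∀ x, q ≤ (P ^ T) x z) :
    ∃ π, IsStationary P π ∧ (∀ π', IsStationary P π' → π' = π) ∧
      ∃ t, IsMixingTime P π (1 / 2) t ∧ t ≤ T * ⌈1 / q⌉₊ := by
  have hPT := pow_mem hP T
  have hq1 : q ≤ 1 := (hz z).trans (le_one_of_mem_rowStochastic hPT)
  obtain ⟨π, hπ⟩ := exists_isStationary hP
  have hπ' := isStationary_iff.1 hπ
  refine ⟨π, hπ, fun ρ hρ => ?_, ?_⟩
  · obtain ⟨-, hρ1, hρP⟩ := isStationary_iff.1 hρ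
    have hd := sum_abs_vecMul_le hPT hz (v := ρ - π)
      (by simp [Finset.sum_sub_distrib, hρ1, hπ'.2.1])
    rw [sub_vecMul, vecMul_pow_of_fixed hρP, vecMul_pow_of_fixed hπ'.2.2] at hd
    have h0 : 0 ≤ ∑ x, |(ρ - π) x| := Finset.sum_nonneg fun x _ => abs_nonneg _
    -- The difference of two stationary distributions is fixed by `P ^ T` and yet contracted by `1 -
    -- q < 1`.
    have h1 : ∑ x, |(ρ - π) x| = 0 := by nlinarith
    funext x
    have := (Finset.sum_eq_zero_iff_of_nonneg fun x _ => abs_nonneg _).1 h1 x (Finset.mem_univ x)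
    exact sub_eq_zero.1 (abs_eq_zero.1 this)
  · set N := ⌈1 / q⌉₊ with hN
    have hmem : T * N ∈ {s : ℕ | ∀ x, tvDist ((P ^ s) x) π ≤ 1 / 2} := by
      intro x
      have hd := sum_abs_vecMul_pow_le hPT hz (v := Pi.single x 1 - π)
        (by simp [Finset.sum_sub_distrib, hπ'.2.1]) hq1 N
      rw [← pow_mul, sub_vecMul, vecMul_pow_of_fixed hπ'.2.2, single_one_vecMul] at hd
      have hn : ∑ y, |(Pi.single x 1 - π : S → ℝ) y| ≤ 2 := by
        calc ∑ y, |(Pi.single x 1 - π : S → ℝ) y|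
            ≤ ∑ y, ((Pi.single x 1 : S → ℝ) y + π y) := by
              refine Finset.sum_le_sum fun y _ => ?_
              have h1 : (0 : ℝ) ≤ (Pi.single x 1 : S → ℝ) y := by
                rw [Pi.single_apply]; split_ifs <;> norm_num
              have h2 := hπ'.1 y
              rw [Pi.sub_apply, abs_le]
              constructor <;> linarith
          _ = 2 := by
              rw [Finset.sum_add_distrib, hπ'.2.1]; simp; norm_num
      have hqN : 1 ≤ q * N := by
        have := Nat.le_ceil (1 / q)
        rw [div_le_iff₀ hq] at this
        rw [mul_comm]; exact this
      -- Since `qN ≥ 1`, the power is at most `1/e`. It multiplies an initial `ℓ¹` distance of at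
      -- most `2`, and `tvDist` is half the result.
      have hpow : (1 - q) ^ N ≤ 1 / 2 := by
        have h1 : (1 - q) ^ N ≤ Real.exp (-q) ^ N :=
          pow_le_pow_left₀ (by linarith) (Real.one_sub_le_exp_neg q) N
        have h2 : Real.exp (-q) ^ N ≤ Real.exp (-1) := by
          rw [← Real.exp_nat_mul]
          exact Real.exp_le_exp.2 (by linarith)
        have h3 : Real.exp (-1) < 0.3678794412 := Real.exp_neg_one_lt_d9
        linarith
      have h0 : 0 ≤ (1 - q) ^ N := pow_nonneg (by linarith) N
      have : ∑ y, |(P ^ (T * N)) x y - π y| ≤ 1 := by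
        refine le_trans ?_ (hd.trans ?_)
        · exact le_of_eq rfl
        · nlinarith
      rw [tvDist]
      linarith
    have hne : {s : ℕ | ∀ x, tvDist ((P ^ s) x) π ≤ 1 / 2}.Nonempty := ⟨_, hmem⟩
    refine ⟨sInf {s : ℕ | ∀ x, tvDist ((P ^ s) x) π ≤ 1 / 2}, ?_, Nat.sInf_le hmem⟩
    have hleast : IsLeast {s : ℕ | ∀ x, tvDist ((P ^ s) x) π ≤ 1 / 2}
        (sInf {s : ℕ | ∀ x, tvDist ((P ^ s) x) π ≤ 1 / 2}) :=
      ⟨Nat.sInf_mem hne, fun s hs => Nat.sInf_le hs⟩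
    unfold IsMixingTime
    convert hleast

end Minorization

/-! ### The transition matrix of `k`-LRU -/

section Transition

open Matrix

variable {n k m : ℕ} {p : Fin n → ℝ}

open Classical in
theorem transition_mem_rowStochastic (hp : ∀ i, 0 < p i) (hsum : ∑ i, p i = 1) :
    transition k m p ∈ rowStochastic ℝ (State n k m) := by
  rw [mem_rowStochastic_iff_sum]
  refine ⟨fun x y => Finset.sum_nonneg fun i _ => ?_, fun x => ?_⟩
  · split_ifs
    exacts [(hp i).le, le_rfl]
  · simp only [transition]
    rw [Finset.sum_comm, ← hsum]
    refine Finset.sum_congr rfl fun i _ => ?_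
    obtain ⟨y, hy⟩ := exists_toConfig_eq_step i x
    rw [Finset.sum_eq_single y]
    · rw [if_pos hy.symm]
    · intro z _ hz
      rw [if_neg fun h => hz (State.toConfig_injective (h.symm.trans hy.symm))]
    · simp

open Classical in
-- The trajectory driven by `w` is one of the nonnegative contributions to this entry of the matrix
-- power.
theorem prod_le_transition_pow (hp : ∀ i, 0 < p i) (hsum : ∑ i, p i = 1) (w : List (Fin n))
    {x z : State n k m} (h : run m w x.toConfig = z.toConfig) :
    (w.map p).prod ≤ (transition k m p ^ w.length) x z := by
  have hP := transition_mem_rowStochastic (k := k) (m := m) hp hsum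
  induction w generalizing x with
  | nil =>
    have : x = z := State.toConfig_injective h
    simp [this]
  | cons i w ih =>
    obtain ⟨y, hy⟩ := exists_toConfig_eq_step i x
    rw [run_cons, ← hy] at h
    rw [List.map_cons, List.prod_cons, List.length_cons, pow_succ', mul_apply]
    have hxy : p i ≤ transition k m p x y := by
      have hs := Finset.single_le_sum
        (f := fun j => if step m j x.toConfig = y.toConfig then p j else 0)
        (fun j _ => by split_ifs; exacts [(hp j).le, le_rfl]) (Finset.mem_univ i)
      rw [if_pos hy.symm] at hs
      exact hs
    calc p i * (w.map p).prod
        ≤ transition k m p x y * (transition k m p ^ w.length) y z :=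
          mul_le_mul hxy (ih h) (List.prod_nonneg (by simp; exact fun j _ => (hp j).le))
            ((hp i).le.trans hxy)
      _ ≤ _ := Finset.single_le_sum
          (f := fun y => transition k m p x y * (transition k m p ^ w.length) y z)
          (fun y _ => mul_nonneg (nonneg_of_mem_rowStochastic hP)
            (nonneg_of_mem_rowStochastic (pow_mem hP _))) (Finset.mem_univ y)

open Classical in
/-- Whatever the initial state, requesting each of `m` items `k` times leads to the same state. -/
theorem exists_minorizing_state (hm : 1 ≤ m) (hp : ∀ i, 0 < p i) (hsum : ∑ i, p i = 1)
    {w : List (Fin n)} (hw : w.Nodup) (hlen : w.length = m) :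
    ∃ z : State n k m, ∀ x, (w.map p).prod ^ k ≤ (transition k m p ^ (k * m)) x z := by
  obtain ⟨z, hz⟩ := exists_toConfig_eq (k := k) (c := fun _ => w.reverse)
    (fun _ => List.nodup_reverse.2 hw) (fun _ => by rw [List.length_reverse, hlen])
  refine ⟨z, fun x => ?_⟩
  have hrun : run m (w.flatMap (List.replicate k)) x.toConfig = z.toConfig := by
    rw [hz]
    funext l
    exact run_coalesces hm hw hlen l (x.length_toConfig l).le (x.nodup_toConfig l)
  have hlen' : (w.flatMap (List.replicate k)).length = k * m := by
    simp [List.length_flatMap, hlen, mul_comm]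
  have hprod : ((w.flatMap (List.replicate k)).map p).prod = (w.map p).prod ^ k := by
    clear hrun hlen' hw hlen hz
    induction w with
    | nil => simp
    | cons i w ih => simp [List.flatMap_cons, ih, mul_pow]
  rw [← hprod, ← hlen']
  exact prod_le_transition_pow hp hsum _ hrun

end Transition

/-! ### Arrangements -/

section Arrangement

variable {n k m : ℕ} {c : Config n k}

theorem arrangement_cons_of_fixed {i : Fin n} {β : List (Fin n)} (h : IsFixed c i β) :
    arrangement c (i :: β) = i :: arrangement c β := if_pos h

theorem arrangement_cons_of_not_fixed {i : Fin n} {β : List (Fin n)} (h : ¬ IsFixed c i β) :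
    arrangement c (i :: β) = arrangement c β := if_neg h

theorem isFixed_iff {i : Fin n} {β : List (Fin n)} : IsFixed c i β ↔ β.count i < height c i := by
  rw [IsFixed, List.count_cons_self, Nat.succ_le_iff]

theorem count_arrangement (c : Config n k) (γ : List (Fin n)) (j : Fin n) :
    (arrangement c γ).count j = min (γ.count j) (height c j) := by
  induction γ with
  | nil => simp [arrangement]
  | cons i β ih =>
    by_cases hf : IsFixed c i β
    · rw [arrangement_cons_of_fixed hf, List.count_cons, List.count_cons, ih]
      rw [isFixed_iff] at hf
      by_cases hij : i = j
      · subst hij; simp; omega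
      · simp [hij]
    · rw [arrangement_cons_of_not_fixed hf, List.count_cons, ih]
      rw [isFixed_iff] at hf
      by_cases hij : i = j
      · subst hij; simp; omega
      · simp [hij]

/-- `dedup` keeps last occurrences, and the last request for an item of positive height is always
fixed. Passing to the arrangement thus preserves the order of last requests. -/
theorem dedup_arrangement (c : Config n k) (γ : List (Fin n)) :
    (arrangement c γ).dedup = γ.dedup.filter fun j => decide (0 < height c j) := by
  have hmem : ∀ β i, i ∈ arrangement c β ↔ i ∈ β ∧ 0 < height c i := by
    intro β i
    rw [← List.count_pos_iff, count_arrangement, lt_min_iff, List.count_pos_iff]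
  induction γ with
  | nil => simp [arrangement]
  | cons i β ih =>
    by_cases hf : IsFixed c i β
    · rw [arrangement_cons_of_fixed hf]
      rw [isFixed_iff] at hf
      have hpos : 0 < height c i := by omega
      by_cases hi : i ∈ β
      · rw [List.dedup_cons_of_mem ((hmem β i).2 ⟨hi, hpos⟩), List.dedup_cons_of_mem hi, ih]
      · rw [List.dedup_cons_of_notMem fun h => hi ((hmem β i).1 h).1,
          List.dedup_cons_of_notMem hi, ih, List.filter_cons_of_pos (by simpa using hpos)]
    · rw [arrangement_cons_of_not_fixed hf, ih]
      rw [isFixed_iff] at hf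
      by_cases hi : i ∈ β
      · rw [List.dedup_cons_of_mem hi]
      · have h0 : ¬ 0 < height c i := by
          rw [List.count_eq_zero_of_not_mem hi] at hf; exact hf
        rw [List.dedup_cons_of_notMem hi, List.filter_cons_of_neg (by simpa using h0)]

theorem arrangement_eq_self {w : List (Fin n)} (h : ∀ i, w.count i ≤ height c i) :
    arrangement c w = w := by
  induction w with
  | nil => rfl
  | cons i w ih =>
    rw [arrangement_cons_of_fixed (h i), ih fun j => ?_]
    exact (List.count_le_count_cons).trans (h j)

theorem arrangement_append_of_height_le {w : List (Fin n)} (h : ∀ i, height c i ≤ w.count i)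
    (γ : List (Fin n)) : arrangement c (γ ++ w) = arrangement c w := by
  induction γ with
  | nil => rfl
  | cons i γ ih =>
    rw [List.cons_append, arrangement_cons_of_not_fixed, ih]
    rw [isFixed_iff, List.count_append]
    have := h i
    omega

theorem arrangement_suffix (γ w : List (Fin n)) :
    arrangement c w <:+ arrangement c (γ ++ w) := by
  induction γ with
  | nil => exact List.suffix_rfl
  | cons i γ ih =>
    rw [List.cons_append]
    by_cases hf : IsFixed c i (γ ++ w)
    · rw [arrangement_cons_of_fixed hf]
      exact ih.trans (List.suffix_cons _ _)
    · rwa [arrangement_cons_of_not_fixed hf]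

theorem height_le_count {γ : List (Fin n)} (h : run m γ (fun _ => []) = c) (i : Fin n) :
    height c i ≤ γ.count i := by
  refine Finset.sup_le fun l _ => ?_
  split_ifs with hl
  · rw [← h] at hl
    exact lt_count_of_mem_run γ hl
  · exact Nat.zero_le _

theorem height_le (c : Config n k) (i : Fin n) : height c i ≤ k := by
  refine Finset.sup_le fun l _ => ?_
  split_ifs <;> omega

theorem height_pos_iff {i : Fin n} : 0 < height c i ↔ ∃ l, i ∈ c l := by
  rw [height, Finset.lt_sup_iff]
  constructor
  · rintro ⟨l, -, h⟩
    by_contra hl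
    push Not at hl
    simp [hl l] at h
  · rintro ⟨l, h⟩
    exact ⟨l, Finset.mem_univ l, by simp [h]⟩

theorem lt_height_of_mem {i : Fin n} {l : Fin k} (h : i ∈ c l) : l.val < height c i := by
  have := Finset.le_sup (f := fun l : Fin k => open Classical in if i ∈ c l then l.val + 1 else 0)
    (Finset.mem_univ l)
  simp only [h, if_true] at this
  exact this

/-- In a class of sample paths, every item occurs in the arrangement as often as its height. -/
theorem count_of_mem_pathClass {a γ : List (Fin n)} (h : γ ∈ pathClass m c a) (i : Fin n) :
    a.count i = height c i := by
  rw [← h.2, count_arrangement, min_eq_right (height_le_count h.1 i)]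

/-- The item of the first fixed request cannot be requested in a gap. -/
theorem head_notMem_gapItems {y : Fin n} {t : List (Fin n)} {δ : ℕ} (hδ : 1 ≤ δ) :
    y ∉ gapItems m c (y :: t) δ := by
  rintro ⟨α, β, hγ, hf, hlen⟩
  obtain ⟨A, hA⟩ := arrangement_suffix (c := c) α (y :: β)
  rw [hγ.2, arrangement_cons_of_not_fixed hf] at hA
  have hcount := count_of_mem_pathClass hγ y
  rw [← hA, List.count_append, count_arrangement] at hcount
  rw [isFixed_iff] at hf
  -- `A` collects the fixed requests before the non-fixed request for `y`. If it is empty then `δ =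
  -- 0`. Otherwise it starts with `y`, although `β` already contains all the fixed requests for `y`.
  cases A with
  | nil =>
    rw [← hA] at hlen
    simp at hlen; omega
  | cons z A =>
    rw [List.cons_append, List.cons.injEq] at hA
    rw [hA.1, List.count_cons_self] at hcount
    omega

/-- A non-fixed request can be inserted after the first fixed one if the arrangement, with this
request inserted, leaves the caches unchanged. -/
theorem mem_gapItems_one {y j : Fin n} {t γ : List (Fin n)} (hγ : γ ∈ pathClass m c (y :: t))
    (hrun : run m (y :: j :: t) c = c) (hj : height c j ≤ t.count j) :
    j ∈ gapItems m c (y :: t) 1 := by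
  have hcount := count_of_mem_pathClass hγ
  have hjf : ¬ IsFixed c j t := by rw [isFixed_iff]; omega
  have hyj : y ≠ j := by
    rintro rfl
    have := hcount y
    rw [List.count_cons_self] at this
    omega
  have ht : arrangement c t = t :=
    arrangement_eq_self fun i => (List.count_le_count_cons).trans (hcount i).le
  have hyf : IsFixed c y (j :: t) := by
    rw [isFixed_iff, List.count_cons_of_ne hyj.symm, ← hcount y, List.count_cons_self]
    omega
  -- `γ` already leads to `c`, so the arrangement with `j` inserted is replayed after it. The replay
  -- holds as many requests for each item as its height, so nothing in `γ` remains fixed.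
  refine ⟨γ ++ [y], t, ⟨?_, ?_⟩, hjf, ?_⟩
  · rw [List.append_assoc, run_append, hγ.1]
    exact hrun
  · rw [List.append_assoc]
    change arrangement c (γ ++ y :: j :: t) = _
    rw [arrangement_append_of_height_le, arrangement_cons_of_fixed hyf,
      arrangement_cons_of_not_fixed hjf, ht]
    intro i
    rw [← hcount i]
    exact ((List.sublist_cons_self j t).cons_cons y).count_le i
  · rw [ht, List.length_cons]

/-- In a valid arrangement each item occurs `height c i ≤ k` times. Finiteness is what makes a class
of maximal weight exist. -/
theorem finite_validArrangements (m : ℕ) (c : Config n k) : (validArrangements m c).Finite := by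
  refine (List.finite_length_le (Fin n) (n * k)).subset ?_
  rintro a ⟨γ, hγ⟩
  have : a.length = ∑ i, a.count i := by
    simpa using (List.sum_toFinset_count_eq_length a).symm.trans
      (Finset.sum_subset (Finset.subset_univ _) fun i _ hi =>
        List.count_eq_zero_of_not_mem (by simpa using hi))
  change a.length ≤ n * k
  rw [this]
  calc ∑ i, a.count i ≤ ∑ _i : Fin n, k := Finset.sum_le_sum fun i _ => by
        rw [count_of_mem_pathClass hγ]; exact height_le c i
    _ = n * k := by simp

theorem exists_isMaxClass (p : Fin n → ℝ) {γ : List (Fin n)} (h : run m γ (fun _ => []) = c) :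
    ∃ a, IsMaxClass m p c a := by
  obtain ⟨a, ha, hmax⟩ := Set.exists_max_image (validArrangements m c) (classWeight m p c)
    (finite_validArrangements m c) ⟨_, γ, h, rfl⟩
  exact ⟨a, ha, hmax⟩

end Arrangement

/-! ### States with equal caches -/

section ConstConfig

variable {n k m : ℕ} {b : List (Fin n)}

theorem filter_mem_take {X : List (Fin n)} (hX : X.Nodup) (m : ℕ) :
    X.filter (· ∈ X.take m) = X.take m := by
  conv_lhs => rw [← List.take_append_drop m X]
  rw [List.filter_append, List.take_append_drop, List.filter_eq_self.2 (by simp),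
    List.filter_eq_nil_iff.2, List.append_nil]
  intro i hi hi'
  exact List.disjoint_take_drop hX le_rfl (by simpa using hi') hi

/-- The first cache is a plain LRU cache, so `b` lists the last requested items, and these are
exactly the items of positive height. This holds for every class, so the maximal one need not be
identified. -/
theorem dedup_of_mem_pathClass (hk : 1 ≤ k) {a γ : List (Fin n)}
    (h : γ ∈ pathClass m (fun _ : Fin k => b) a) : a.dedup.reverse = b := by
  have hb : b = γ.dedup.reverse.take m := by
    have := congrFun h.1 ⟨0, hk⟩
    rw [run_first γ rfl (by simp), moveToFront_eq γ List.nodup_nil] at this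
    simpa using this.symm
  have hX : γ.dedup.reverse.Nodup := List.nodup_reverse.2 γ.nodup_dedup
  rw [← h.2, dedup_arrangement, ← List.filter_reverse]
  conv_rhs => rw [hb, ← filter_mem_take hX m, ← hb]
  apply List.filter_congr
  intro j _
  have : (∃ _l : Fin k, j ∈ b) ↔ j ∈ b := ⟨fun ⟨_, h⟩ => h, fun h => ⟨⟨0, hk⟩, h⟩⟩
  simp only [height_pos_iff, this]

theorem moveToFront_eq_of_dedup {w L : List (Fin n)} (hL : L.Nodup) (hw : w.dedup.reverse = b)
    (hLb : ∀ i ∈ L, i ∈ b) : moveToFront w L = b := by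
  rw [moveToFront_eq w hL, hw, List.filter_eq_nil_iff.2, List.append_nil]
  intro i hi
  have := hLb i hi
  rw [← hw, List.mem_reverse, List.mem_dedup] at this
  simpa using this

/-- All requests of `y :: j :: t` are hits in every cache and only reorder it. As `j` occurs again
in `t`, the extra request leaves no trace in the final order. -/
theorem mem_gapItems_of_mem (hk : 1 ≤ k) (hb : b.Nodup) (hlen : b.length = m) {y j : Fin n}
    {t γ : List (Fin n)} (hγ : γ ∈ pathClass m (fun _ : Fin k => b) (y :: t)) (hj : j ∈ b)
    (hjy : j ≠ y) : j ∈ gapItems m (fun _ : Fin k => b) (y :: t) 1 := by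
  have hd := dedup_of_mem_pathClass hk hγ
  have hmem : ∀ i, i ∈ y :: t ↔ i ∈ b := fun i => by
    rw [← hd, List.mem_reverse, List.mem_dedup]
  have hjt : j ∈ t := by simpa [hjy] using (hmem j).2 hj
  refine mem_gapItems_one hγ ?_ ?_
  · funext l
    rw [run_of_forall_mem _ _ hlen.le]
    · refine moveToFront_eq_of_dedup hb ?_ fun i hi => hi
      rw [← hd]
      congr 1
      by_cases hy : y ∈ t
      · rw [List.dedup_cons_of_mem (List.mem_cons_of_mem _ hy), List.dedup_cons_of_mem hjt,
          List.dedup_cons_of_mem hy]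
      · rw [List.dedup_cons_of_notMem (by simpa [hjy.symm] using hy), List.dedup_cons_of_mem hjt,
          List.dedup_cons_of_notMem hy]
    · intro i hi
      rw [← hmem]
      simp only [List.mem_cons] at hi ⊢
      rcases hi with h | rfl | h
      exacts [Or.inl h, Or.inr hjt, Or.inr h]
  · rw [← count_of_mem_pathClass hγ j, List.count_cons_of_ne hjy.symm]

/-- The foreign item `j` enters only the first cache, since no cache held it before. The requests in
`t` cover all of `b` and flush it out again. -/
theorem mem_gapItems_of_notMem (hk : 2 ≤ k) (hb : b.Nodup) (hlen : b.length = m) {y j : Fin n}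
    {t γ : List (Fin n)} (hγ : γ ∈ pathClass m (fun _ : Fin k => b) (y :: t)) (hj : j ∉ b) :
    j ∈ gapItems m (fun _ : Fin k => b) (y :: t) 1 := by
  have hd := dedup_of_mem_pathClass (by omega) hγ
  have hmem : ∀ i, i ∈ y :: t ↔ i ∈ b := fun i => by
    rw [← hd, List.mem_reverse, List.mem_dedup]
  have hyb : y ∈ b := (hmem y).1 List.mem_cons_self
  -- This is where `k ≥ 2` matters: `y` lies in the last cache, so it has at least two fixed
  -- requests.
  have hyt : y ∈ t := by
    have h1 := count_of_mem_pathClass hγ y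
    have h2 := lt_height_of_mem (c := fun _ : Fin k => b) (l := ⟨k - 1, by omega⟩) hyb
    rw [List.count_cons_self] at h1
    simp only at h2
    exact List.count_pos_iff.1 (by omega)
  rw [List.dedup_cons_of_mem hyt] at hd
  have htb : ∀ i ∈ t, i ∈ b := fun i hi => (hmem i).1 (List.mem_cons_of_mem _ hi)
  refine mem_gapItems_one hγ ?_ ?_
  · set c₁ : Config n k := step m y (fun _ => b) with hc₁
    set c₂ : Config n k := step m j c₁ with hc₂
    have hlen₁ : ∀ l, (c₁ l).length = m := fun l => length_step hlen
    have hnod₁ : ∀ l, (c₁ l).Nodup := fun l => nodup_step hb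
    have hmem₁ : ∀ l i, i ∈ c₁ l ↔ i ∈ b := by
      intro l i
      have : c₁ l = y :: b.erase y := by
        rw [hc₁, step_of_admits (Or.inl hyb), List.take_of_length_le]
        have := List.length_pos_of_mem hyb
        rw [List.length_cons, List.length_erase_of_mem hyb, ← hlen]
        omega
      rw [this, (List.perm_cons_erase hyb).mem_iff]
    rw [run_cons, run_cons, ← hc₁, ← hc₂]
    funext l
    rcases Nat.eq_zero_or_pos l.val with h0 | h0
    · rw [run_first t h0 (length_step (hlen₁ l)).le, moveToFront_eq t (nodup_step (hnod₁ l)), hd,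
        List.take_append_of_le_length hlen.ge, List.take_of_length_le hlen.le]
    · have h₂ : c₂ l = c₁ l := by
        apply step_of_not_admits
        simp only [hmem₁, hj, false_or, imp_false, not_forall, not_not]
        exact ⟨⟨l.val - 1, by omega⟩, by simp; omega⟩
      rw [run_of_forall_mem t, h₂]
      · exact moveToFront_eq_of_dedup (hnod₁ l) hd fun i hi => (hmem₁ l i).1 hi
      · intro i hi
        rw [h₂, hmem₁]
        exact htb i hi
      · rw [h₂, hlen₁]
  · have : ¬ 0 < height (fun _ : Fin k => b) j := by
      rw [height_pos_iff]; rintro ⟨-, h⟩; exact hj h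
    omega

end ConstConfig

/-! ### Bounds for `maxGapProb` -/

section MaxGapProb

variable {n k m : ℕ} {p : Fin n → ℝ}

theorem sum_prob_Icc (p : Fin n → ℝ) {r : ℕ} (hr : r ≤ n) :
    ∑ j ∈ Finset.Icc 1 r, prob p j = ∑ i : Fin n, if i.val < r then p i else 0 := by
  rw [← Finset.sum_filter]
  refine (Finset.sum_nbij (fun i : Fin n => i.val + 1) ?_ ?_ ?_ ?_).symm
  · intro i hi
    simp at hi ⊢; omega
  · intro i _ j _ h
    simpa [Fin.ext_iff] using h
  · intro j hj
    simp at hj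
    exact ⟨⟨j - 1, by omega⟩, by simp; omega, by simp; omega⟩
  · intro i _
    rw [prob, dif_pos (by omega)]
    simp

open Classical in
theorem sum_gapItems_le (hp : ∀ i, 0 < p i) (hsum : ∑ i, p i = 1) {ε : ℝ} (hε : ∀ i, ε ≤ p i)
    {c : Config n k} {a : List (Fin n)} {δ : ℕ} (h1 : 1 ≤ δ) (h2 : δ < a.length) :
    ∑ j, (if j ∈ gapItems m c a δ then p j else 0) ≤ 1 - ε := by
  obtain ⟨y, t, rfl⟩ := List.exists_cons_of_length_pos (by omega : 0 < a.length)
  calc ∑ j, (if j ∈ gapItems m c (y :: t) δ then p j else 0)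
      ≤ ∑ j, (p j - if j = y then p j else 0) := by
        refine Finset.sum_le_sum fun j _ => ?_
        by_cases hj : j = y
        · subst hj
          simp [head_notMem_gapItems h1]
        · rw [if_neg hj, sub_zero]
          split_ifs
          exacts [le_rfl, (hp j).le]
    _ = 1 - p y := by simp [Finset.sum_sub_distrib, hsum]
    _ ≤ 1 - ε := by linarith [hε y]

theorem maxGapProb_le (hp : ∀ i, 0 < p i) (hsum : ∑ i, p i = 1) {ε : ℝ} (hε : ∀ i, ε ≤ p i)
    (hε1 : ε ≤ 1) : maxGapProb k m p ≤ 1 - ε := by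
  -- The supremum of the empty set is `0`, which is why `ε ≤ 1` is needed.
  refine Real.sSup_le ?_ (by linarith)
  rintro s ⟨x, a, δ, -, h1, h2, rfl⟩
  exact sum_gapItems_le hp hsum hε h1 h2

theorem maxGapProb_nonneg (hp : ∀ i, 0 < p i) : 0 ≤ maxGapProb k m p := by
  refine Real.sSup_nonneg ?_
  rintro s ⟨x, a, δ, -, h1, h2, rfl⟩
  refine Finset.sum_nonneg fun j _ => ?_
  split_ifs
  exacts [(hp j).le, le_rfl]

/-- If, for all classes of sample paths leading to the state with all caches equal to `b`, the items
before `r` can be requested after the first fixed request, then their total probability is at most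
`maxGapProb`. -/
theorem sum_prob_le_maxGapProb (hk : 1 ≤ k) (hm : 2 ≤ m) (hp : ∀ i, 0 < p i) (hsum : ∑ i, p i = 1)
    {r : ℕ} (hr : r ≤ n) {b : List (Fin n)} (hb : b.Nodup) (hlen : b.length = m)
    (hgap : ∀ (y : Fin n) (t γ : List (Fin n)), γ ∈ pathClass m (fun _ : Fin k => b) (y :: t) →
      ∀ j : Fin n, j.val < r → j ∈ gapItems m (fun _ : Fin k => b) (y :: t) 1) :
    ∑ j ∈ Finset.Icc 1 r, prob p j ≤ maxGapProb k m p := by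
  obtain ⟨x, hx⟩ := exists_toConfig_eq (k := k) (c := fun _ => b) (fun _ => hb) (fun _ => hlen)
  have hrun : run m (b.reverse.flatMap (List.replicate k)) (fun _ => []) = x.toConfig := by
    rw [hx]
    funext l
    rw [run_coalesces (by omega) (List.nodup_reverse.2 hb) (by simpa using hlen) l (by simp)
      (by simp), List.reverse_reverse]
  obtain ⟨a, ha⟩ := exists_isMaxClass p hrun
  obtain ⟨γ, hγ⟩ := ha.1
  have hγ' := hγ
  rw [hx] at hγ'
  have hd := dedup_of_mem_pathClass hk hγ'
  -- With `m ≥ 2` this makes `δ = 1` an admissible gap.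
  have hal : m ≤ a.length := by
    rw [← hlen, ← hd, List.length_reverse]
    exact (List.dedup_sublist a).length_le
  have hbdd : BddAbove {s | ∃ (x : State n k m) (a : List (Fin n)) (δ : ℕ),
      IsMaxClass m p x.toConfig a ∧ 1 ≤ δ ∧ δ < a.length ∧
        s = ∑ j, open Classical in if j ∈ gapItems m x.toConfig a δ then p j else 0} := by
    refine ⟨1 - 0, ?_⟩
    rintro s ⟨x, a, δ, -, h1, h2, rfl⟩
    exact sum_gapItems_le hp hsum (fun i => (hp i).le) h1 h2
  refine le_trans ?_ (le_csSup hbdd ⟨x, a, 1, ha, le_rfl, by omega, rfl⟩)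
  rw [sum_prob_Icc p hr]
  obtain ⟨y, t, rfl⟩ := List.exists_cons_of_length_pos (by omega : 0 < a.length)
  refine Finset.sum_le_sum fun j _ => ?_
  by_cases hj : j.val < r
  · rw [if_pos hj, if_pos]
    rw [hx]
    exact hgap y t γ hγ' j hj
  · rw [if_neg hj]
    split_ifs
    exacts [(hp j).le, le_rfl]

/-- The `m - 1` most popular items have total probability at most `maxGapProb`. -/
theorem sum_prob_top_le_maxGapProb (hk : 1 ≤ k) (hm : 1 ≤ m) (hn : m < n) (hkm : k * m ≤ n)
    (hp : ∀ i, 0 < p i) (hsum : ∑ i, p i = 1) :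
    ∑ j ∈ Finset.Icc 1 (m - 1), prob p j ≤ maxGapProb k m p := by
  rcases hm.eq_or_lt with rfl | hm
  · simpa using maxGapProb_nonneg hp
  rcases hk.eq_or_lt with rfl | hk
  -- For `k = 1` the cache holds items `1, …, m` in this order. Arrangements have no repetition, so
  -- the only one is `b` reversed. Its first request is for item `m`, and the other `m - 1` items
  -- fit in the first gap.
  · set b : List (Fin n) := List.ofFn (Fin.castLEEmb hn.le) with hb
    have hbn : b.Nodup := List.nodup_ofFn.2 (Fin.castLEEmb hn.le).injective
    have hbl : b.length = m := by simp [hb]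
    refine sum_prob_le_maxGapProb le_rfl hm hp hsum (by omega) hbn hbl ?_
    intro y t γ hγ j hj
    have hnod : (y :: t).Nodup := by
      rw [List.nodup_iff_count_le_one]
      intro i
      rw [count_of_mem_pathClass hγ]
      exact height_le _ _
    have hd := dedup_of_mem_pathClass le_rfl hγ
    rw [hnod.dedup, List.reverse_cons] at hd
    have hy : y.val = m - 1 := by
      have hlt : t.length = m - 1 := by
        have := congrArg List.length hd
        simp [hbl] at this
        omega
      have h1 : b[m - 1]? = some y := by
        rw [← hd, ← hlt]
        simp
      rw [List.getElem?_eq_getElem (by omega), Option.some_inj] at h1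
      rw [← h1]
      simp [hb]
    refine mem_gapItems_of_mem le_rfl hbn hbl hγ ?_ ?_
    · rw [hb, List.mem_ofFn]
      exact ⟨⟨j.val, by omega⟩, by simp⟩
    · rintro rfl
      omega
  · have h2m : 2 * m ≤ n := (Nat.mul_le_mul_right m hk).trans hkm
    -- For `k ≥ 2` the caches hold the last `m` items. Since `2m ≤ n`, none of the first `m - 1`
    -- items is among them.
    set b : List (Fin n) := List.ofFn fun i : Fin m => ⟨n - m + i.val, by omega⟩ with hb
    have hbn : b.Nodup := List.nodup_ofFn.2 fun i j h => by simpa [Fin.ext_iff] using h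
    have hbl : b.length = m := by simp [hb]
    refine sum_prob_le_maxGapProb (by omega) hm hp hsum (by omega) hbn hbl ?_
    intro y t γ hγ j hj
    refine mem_gapItems_of_notMem hk hbn hbl hγ ?_
    rw [hb, List.mem_ofFn]
    rintro ⟨i, rfl⟩
    simp at hj
    omega

end MaxGapProb

/-! ### The bound -/

section Bound

variable {n k m : ℕ} {p : Fin n → ℝ}

theorem prob_eq (p : Fin n → ℝ) {j : ℕ} (h1 : 1 ≤ j) (h2 : j ≤ n) :
    prob p j = p ⟨j - 1, by omega⟩ := dif_pos ⟨h1, h2⟩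

theorem prob_pos (hp : ∀ i, 0 < p i) {j : ℕ} (h1 : 1 ≤ j) (h2 : j ≤ n) : 0 < prob p j := by
  rw [prob_eq p h1 h2]; exact hp _

theorem prob_nonneg (hp : ∀ i, 0 < p i) (j : ℕ) : 0 ≤ prob p j := by
  rw [prob]; split_ifs
  exacts [(hp _).le, le_rfl]

theorem prob_le_one (hp : ∀ i, 0 < p i) (hsum : ∑ i, p i = 1) (j : ℕ) : prob p j ≤ 1 := by
  rw [prob]; split_ifs
  · rw [← hsum]; exact Finset.single_le_sum (fun i _ => (hp i).le) (Finset.mem_univ _)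
  · exact zero_le_one

theorem prob_anti (ha : Antitone p) {i j : ℕ} (h1 : 1 ≤ i) (hij : i ≤ j) (hj : j ≤ n) :
    prob p j ≤ prob p i := by
  rw [prob_eq p h1 (hij.trans hj), prob_eq p (h1.trans hij) hj]
  exact ha (by simp; omega)

theorem sum_prob (hsum : ∑ i, p i = 1) : ∑ j ∈ Finset.Icc 1 n, prob p j = 1 := by
  rw [sum_prob_Icc p le_rfl, ← hsum]
  simp

theorem prob_two_le (hn : 2 ≤ n) (hp : ∀ i, 0 < p i) (hsum : ∑ i, p i = 1) (ha : Antitone p) :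
    prob p 2 ≤ 1 / 2 := by
  have h := Finset.sum_le_sum_of_subset_of_nonneg (f := prob p) (s := {1, 2})
    (t := Finset.Icc 1 n) (by intro j hj; simp at hj ⊢; omega) fun j _ _ => prob_nonneg hp j
  rw [sum_prob hsum, Finset.sum_pair (by norm_num)] at h
  linarith [prob_anti ha (le_refl 1) (by norm_num : 1 ≤ 2) hn]

theorem one_le_mul_prob_one (hsum : ∑ i, p i = 1) (ha : Antitone p) :
    1 ≤ n * prob p 1 := by
  rw [← sum_prob hsum]
  calc ∑ j ∈ Finset.Icc 1 n, prob p j ≤ ∑ _j ∈ Finset.Icc 1 n, prob p 1 :=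
        Finset.sum_le_sum fun j hj => by
          rw [Finset.mem_Icc] at hj; exact prob_anti ha le_rfl hj.1 hj.2
    _ = n * prob p 1 := by simp

theorem one_sub_sum_prob_eq (hm : 1 ≤ m) (hn : m ≤ n) (hsum : ∑ i, p i = 1) :
    1 - ∑ j ∈ Finset.Icc 1 (m - 1), prob p j = ∑ j ∈ Finset.Icc m n, prob p j := by
  have hu : Finset.Icc 1 n = Finset.Icc 1 (m - 1) ∪ Finset.Icc m n := by
    ext j; simp; omega
  have hd : Disjoint (Finset.Icc 1 (m - 1)) (Finset.Icc m n) := by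
    rw [Finset.disjoint_left]; intro j; simp; omega
  have := sum_prob hsum
  rw [hu, Finset.sum_union hd] at this
  linarith

theorem one_sub_sum_prob_le (hm : 1 ≤ m) (hn : m ≤ n) (hp : ∀ i, 0 < p i) (hsum : ∑ i, p i = 1)
    (ha : Antitone p) : 1 - ∑ j ∈ Finset.Icc 1 (m - 1), prob p j ≤ n * prob p m := by
  rw [one_sub_sum_prob_eq hm hn hsum]
  calc ∑ j ∈ Finset.Icc m n, prob p j ≤ ∑ _j ∈ Finset.Icc m n, prob p m :=
        Finset.sum_le_sum fun j hj => by
          rw [Finset.mem_Icc] at hj; exact prob_anti ha hm hj.1 hj.2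
    _ = (n + 1 - m : ℕ) * prob p m := by simp
    _ ≤ n * prob p m := by
        refine mul_le_mul_of_nonneg_right ?_ (prob_nonneg hp m)
        exact_mod_cast (by omega : n + 1 - m ≤ n)

/-- `(1 - s)^(m - 1)` is at most `n^m` times the product of the `m` largest probabilities. -/
theorem one_sub_pow_le (hm : 1 ≤ m) (hn : m ≤ n) (hp : ∀ i, 0 < p i) (hsum : ∑ i, p i = 1)
    (ha : Antitone p) {s : ℝ} (hs : ∑ j ∈ Finset.Icc 1 (m - 1), prob p j ≤ s) (hs1 : s ≤ 1) :
    (1 - s) ^ (m - 1) ≤ n ^ m * ∏ j ∈ Finset.Icc 1 m, prob p j := by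
  have hp0 := prob_nonneg hp
  have h1 := one_sub_sum_prob_le hm hn hp hsum ha
  have h2 : prob p 1 * prob p m ^ (m - 1) ≤ ∏ j ∈ Finset.Icc 1 m, prob p j := by
    rw [← Finset.mul_prod_Ioc_eq_prod_Icc hm]
    refine mul_le_mul_of_nonneg_left ?_ (hp0 1)
    calc prob p m ^ (m - 1) = ∏ _j ∈ Finset.Ioc 1 m, prob p m := by simp
      _ ≤ _ := Finset.prod_le_prod (fun _ _ => hp0 m) fun j hj => by
          rw [Finset.mem_Ioc] at hj; exact prob_anti ha hj.1.le hj.2 hn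
  calc (1 - s) ^ (m - 1) ≤ (n * prob p m) ^ (m - 1) :=
        pow_le_pow_left₀ (by linarith) (by linarith) _
    _ = 1 * (n ^ (m - 1) * prob p m ^ (m - 1)) := by rw [mul_pow, one_mul]
    -- Only `m - 1` factors `1 - s` are available for `m` probabilities. The spare one, `p_1`, is
    -- paid for by `n p_1 ≥ 1`.
    _ ≤ (n * prob p 1) * (n ^ (m - 1) * prob p m ^ (m - 1)) :=
        mul_le_mul_of_nonneg_right (one_le_mul_prob_one hsum ha)
          (mul_nonneg (by positivity) (pow_nonneg (hp0 m) _))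
    _ = n ^ m * (prob p 1 * prob p m ^ (m - 1)) := by
        obtain ⟨r, rfl⟩ := Nat.exists_eq_add_of_le' hm
        simp only [Nat.add_sub_cancel]; ring
    _ ≤ _ := mul_le_mul_of_nonneg_left h2 (by positivity)

theorem leastProd_pos (hkm : k * m ≤ n) (hp : ∀ i, 0 < p i) : 0 < leastProd k m p := by
  refine Finset.prod_pos fun i hi => pow_pos (Finset.prod_pos fun l hl => ?_) _
  rw [Finset.mem_Icc] at hi hl
  have : i * m ≤ k * m := Nat.mul_le_mul_right m hi.2
  exact prob_pos hp (by omega) (by omega)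

theorem leastProd_le (hk : 1 ≤ k) (hp : ∀ i, 0 < p i) (hsum : ∑ i, p i = 1) :
    leastProd k m p ≤ (∏ l ∈ Finset.Icc 1 m, prob p (n - l + 1)) ^ k := by
  have hp0 := prob_nonneg hp
  rw [leastProd, ← Finset.mul_prod_Ioc_eq_prod_Icc hk]
  have h1 : ∏ i ∈ Finset.Ioc 1 k,
      (∏ l ∈ Finset.Icc (1 + (i - 1) * m) (i * m), prob p (n - l + 1)) ^ (k - i + 1) ≤ 1 :=
    Finset.prod_le_one (fun i _ => pow_nonneg (Finset.prod_nonneg fun l _ => hp0 _) _)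
      fun i _ => pow_le_one₀ (Finset.prod_nonneg fun l _ => hp0 _)
        (Finset.prod_le_one (fun l _ => hp0 _) fun l _ => prob_le_one hp hsum _)
  refine (mul_le_of_le_one_right (pow_nonneg (Finset.prod_nonneg fun l _ => hp0 _) _) h1).trans ?_
  rw [Nat.sub_self, zero_mul, one_mul, add_zero, Nat.sub_add_cancel hk]

theorem leastProd_le_prod (hk : 1 ≤ k) (hn : m ≤ n) (hp : ∀ i, 0 < p i) (hsum : ∑ i, p i = 1)
    (ha : Antitone p) : leastProd k m p ≤ (∏ j ∈ Finset.Icc 1 m, prob p j) ^ k := by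
  have hp0 := prob_nonneg hp
  refine (leastProd_le hk hp hsum).trans
    (pow_le_pow_left₀ (Finset.prod_nonneg fun l _ => hp0 _) ?_ k)
  -- Reversing the index pairs `p_{n-l+1}` with `p_{m-l+1}`, so that monotonicity applies factor by
  -- factor.
  have hrefl : ∏ j ∈ Finset.Icc 1 m, prob p j = ∏ l ∈ Finset.Icc 1 m, prob p (m - l + 1) := by
    refine Finset.prod_nbij' (fun j => m - j + 1) (fun j => m - j + 1) ?_ ?_ ?_ ?_ ?_
    · intro j hj; simp at hj ⊢; omega
    · intro j hj; simp at hj ⊢; omega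
    · intro j hj; simp at hj ⊢; omega
    · intro j hj; simp at hj ⊢; omega
    · intro j hj
      rw [Finset.mem_Icc] at hj
      congr 1
      omega
  rw [hrefl]
  refine Finset.prod_le_prod (fun l _ => hp0 _) fun l hl => ?_
  rw [Finset.mem_Icc] at hl
  exact prob_anti ha (by omega) (by omega) (by omega)

/-- One factor is `p_n ≤ p_2 ≤ 1/2`, and the others are at most `1`. This keeps the logarithm in the
bound above `log 2`. -/
theorem leastProd_le_half (hk : 1 ≤ k) (hm : 1 ≤ m) (hn : m < n) (hp : ∀ i, 0 < p i)
    (hsum : ∑ i, p i = 1) (ha : Antitone p) : leastProd k m p ≤ 1 / 2 := by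
  have hp0 := prob_nonneg hp
  have hle : ∏ l ∈ Finset.Icc 1 m, prob p (n - l + 1) ≤ 1 / 2 := by
    rw [← Finset.mul_prod_Ioc_eq_prod_Icc hm]
    refine (mul_le_of_le_one_right (hp0 _)
      (Finset.prod_le_one (fun l _ => hp0 _) fun l _ => prob_le_one hp hsum _)).trans ?_
    exact (prob_anti ha (by norm_num) (by omega) (by omega)).trans
      (prob_two_le (by omega) hp hsum ha)
  have h0 : 0 ≤ ∏ l ∈ Finset.Icc 1 m, prob p (n - l + 1) := Finset.prod_nonneg fun l _ => hp0 _
  exact ((leastProd_le hk hp hsum).trans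
    (pow_le_of_le_one h0 (by linarith) (by omega))).trans hle

/-- The bound dominates the inverse of the coalescence probability. -/
theorem le_mixingBound (hk : 1 ≤ k) (hm : 1 ≤ m) (hn : m < n) (hkm : k * m ≤ n)
    (hp : ∀ i, 0 < p i) (hsum : ∑ i, p i = 1) (ha : Antitone p) {s : ℝ}
    (hs : ∑ j ∈ Finset.Icc 1 (m - 1), prob p j ≤ s) (hs1 : s < 1) :
    Real.log 2 / (∏ j ∈ Finset.Icc 1 m, prob p j) ^ k ≤ mixingBound k m p s := by
  have hn1 : (1 : ℝ) ≤ n := by exact_mod_cast (by omega : 1 ≤ n)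
  set r := ∏ j ∈ Finset.Icc 1 m, prob p j with hr
  set D := leastProd k m p with hD
  set e := k * (k + 1) * m / 2 - 1 with he
  have hr0 : 0 < r := Finset.prod_pos fun j hj => by
    rw [Finset.mem_Icc] at hj; exact prob_pos hp hj.1 (by omega)
  have hD0 : 0 < D := leastProd_pos hkm hp
  have hDq : D ≤ r ^ k := leastProd_le_prod hk hn.le hp hsum ha
  have hDhalf : D ≤ 1 / 2 := leastProd_le_half hk hm hn hp hsum ha
  have hpn0 : 0 < prob p n := prob_pos hp (by omega) le_rfl
  have hpn1 := prob_le_one hp hsum n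
  have hs0 : 0 ≤ s := (Finset.sum_nonneg fun j _ => prob_nonneg hp j).trans hs
  have hu : 0 < 1 - s := by linarith
  -- This uses `k + 1 ≥ 2`, so that `km ≤ k(k+1)m/2`, and `k ≥ 1` to absorb the `-1`.
  have hexp : k * (m - 1) ≤ e := by
    have h1 : k * m ≤ k * (k + 1) * m / 2 := by
      rw [Nat.le_div_iff_mul_le (by norm_num)]
      nlinarith [Nat.mul_le_mul_right (k * m) (by omega : 2 ≤ k + 1)]
    have h2 : k * (m - 1) + 1 ≤ k * m := by
      obtain ⟨r, rfl⟩ := Nat.exists_eq_add_of_le' hm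
      simp only [Nat.add_sub_cancel]; nlinarith
    omega
  have hpow : (1 - s) ^ e ≤ n ^ (k * m) * r ^ k := by
    calc (1 - s) ^ e ≤ (1 - s) ^ (k * (m - 1)) :=
          pow_le_pow_of_le_one hu.le (by linarith) hexp
      _ = ((1 - s) ^ (m - 1)) ^ k := by rw [mul_comm, pow_mul]
      _ ≤ (n ^ m * r) ^ k := pow_le_pow_left₀ (by positivity)
          (one_sub_pow_le hm hn.le hp hsum ha hs hs1.le) k
      _ = n ^ (k * m) * r ^ k := by rw [mul_pow, ← pow_mul, mul_comm m k]
  have hA : 1 ≤ (n : ℝ) ^ (k * m) * (r ^ k * (1 / (1 - s)) ^ e) := by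
    rw [one_div, inv_pow, ← mul_assoc, ← div_eq_mul_inv, one_le_div (by positivity)]
    exact hpow
  have hden : D ^ 2 * prob p n ^ 2 ≤ r ^ k := by
    calc D ^ 2 * prob p n ^ 2 ≤ D ^ 2 * 1 :=
          mul_le_mul_of_nonneg_left (pow_le_one₀ hpn0.le hpn1) (by positivity)
      _ = D * D := by ring
      _ ≤ r ^ k * 1 := mul_le_mul hDq (by linarith) hD0.le (by positivity)
      _ = r ^ k := mul_one _
  have hlog : Real.log 2 ≤ Real.log (1 / D) := by
    refine Real.log_le_log (by norm_num) ?_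
    rw [le_div_iff₀ hD0]
    linarith
  have hlog2 : 0 < Real.log 2 := Real.log_pos (by norm_num)
  -- A single factor `1/D` already supplies `1/r^k`. The power `n^{4km}` is spent on the bracket
  -- through `hA`, and the remaining power of `n` is merely at least `1`.
  have hmain : 1 / r ^ k ≤ (n : ℝ) ^ (4 * k * m + 4 * (m - 1) * e) / (D ^ 2 * prob p n ^ 2) *
      (r ^ k * (1 / (1 - s)) ^ e) ^ 4 := by
    calc 1 / r ^ k ≤ 1 / (D ^ 2 * prob p n ^ 2) :=
          one_div_le_one_div_of_le (by positivity) hden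
      _ ≤ ((n : ℝ) ^ (4 * (m - 1) * e) *
            ((n : ℝ) ^ (k * m) * (r ^ k * (1 / (1 - s)) ^ e)) ^ 4) / (D ^ 2 * prob p n ^ 2) := by
          refine div_le_div_of_nonneg_right ?_ (by positivity)
          exact one_le_mul_of_one_le_of_one_le (one_le_pow₀ hn1) (one_le_pow₀ hA)
      _ = _ := by
          rw [pow_add, mul_pow ((n : ℝ) ^ (k * m)), ← pow_mul,
            (by ring : k * m * 4 = 4 * k * m)]
          ring
  rw [mixingBound, div_eq_mul_one_div, mul_comm]
  exact mul_le_mul hmain hlog hlog2.le ((one_div_pos.2 (by positivity)).le.trans hmain)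

end Bound

end KLRU

theorem mainTheorem1 (k m : ℕ) (hk : 1 ≤ k) (hm : 1 ≤ m) :
    ∃ C : ℝ, 0 < C ∧ ∀ (n : ℕ) (p : Fin n → ℝ), m < n → k * m ≤ n →
      (∀ i, 0 < p i) → ∑ i, p i = 1 → Antitone p →
      KLRU.maxGapProb k m p < 1 ∧
      ∃ π : KLRU.State n k m → ℝ,
        KLRU.IsStationary (KLRU.transition k m p) π ∧
        (∀ π', KLRU.IsStationary (KLRU.transition k m p) π' → π' = π) ∧
        ∃ t : ℕ, KLRU.IsMixingTime (KLRU.transition k m p) π (1 / 2) t ∧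
          (t : ℝ) ≤ C * KLRU.mixingBound k m p (KLRU.maxGapProb k m p) ∧
          (t : ℝ) ≤ C * KLRU.mixingBound k m p (∑ j ∈ Finset.Icc 1 (m - 1), KLRU.prob p j) := by
  classical
  have hlog2 : 0 < Real.log 2 := Real.log_pos (by norm_num)
  have hkm0 : (0 : ℝ) < k * m := by exact_mod_cast Nat.mul_pos hk hm
  -- Here `km` is the length of one coalescing round, `2` comes from `⌈1/q⌉ ≤ 2/q`, and `log 2` is
  -- the lower bound for the logarithm in `B`.
  refine ⟨2 * (k * m) / Real.log 2, by positivity, fun n p hn hkm hp hsum ha => ?_⟩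
  set q := (∏ j ∈ Finset.Icc 1 m, KLRU.prob p j) ^ k with hq
  have hq0 : 0 < q := pow_pos (Finset.prod_pos fun j hj => by
    rw [Finset.mem_Icc] at hj; exact KLRU.prob_pos hp hj.1 (by omega)) k
  have hq1 : q ≤ 1 := pow_le_one₀ (Finset.prod_nonneg fun j _ => KLRU.prob_nonneg hp j)
    (Finset.prod_le_one (fun j _ => KLRU.prob_nonneg hp j)
      fun j _ => KLRU.prob_le_one hp hsum j)
  have hlast : ∀ i, p ⟨n - 1, by omega⟩ ≤ p i := fun i => ha (by
    rw [Fin.le_def]; simp only; omega)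
  have hlast1 : p ⟨n - 1, by omega⟩ ≤ 1 := by
    rw [← hsum]; exact Finset.single_le_sum (fun i _ => (hp i).le) (Finset.mem_univ _)
  have hs1 : KLRU.maxGapProb k m p < 1 := by
    have := KLRU.maxGapProb_le (k := k) (m := m) hp hsum hlast hlast1
    linarith [hp ⟨n - 1, by omega⟩]
  have hs := KLRU.sum_prob_top_le_maxGapProb hk hm hn hkm hp hsum
  have hbound : ∀ s, ∑ j ∈ Finset.Icc 1 (m - 1), KLRU.prob p j ≤ s → s < 1 →
      2 * (k * m) / q ≤ 2 * (k * m) / Real.log 2 * KLRU.mixingBound k m p s := by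
    intro s h0 h1
    have := KLRU.le_mixingBound hk hm hn hkm hp hsum ha h0 h1
    calc 2 * (k * m) / q = 2 * (k * m) / Real.log 2 * (Real.log 2 / q) := by
          field_simp
      _ ≤ _ := mul_le_mul_of_nonneg_left this (by positivity)
  set w : List (Fin n) := List.ofFn (Fin.castLEEmb hn.le) with hw
  have hwprod : (w.map p).prod ^ k = q := by
    rw [hq, hw, List.map_ofFn, List.prod_ofFn]
    congr 1
    refine Finset.prod_nbij (fun i : Fin m => i.val + 1) ?_ ?_ ?_ ?_
    · intro i _; simp
    · intro i _ j _ h; simpa [Fin.ext_iff] using h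
    · intro j hj
      simp at hj
      exact ⟨⟨j - 1, by omega⟩, by simp, by simp; omega⟩
    · intro i _
      rw [KLRU.prob_eq p (by omega) (by omega)]
      rfl
  obtain ⟨z, hz⟩ := KLRU.exists_minorizing_state (k := k) hm hp hsum
    (List.nodup_ofFn.2 (Fin.castLEEmb hn.le).injective) (by simp [hw] : w.length = m)
  have : Nonempty (KLRU.State n k m) := ⟨z⟩
  rw [hwprod] at hz
  obtain ⟨π, hπ, huniq, t, ht, htle⟩ := KLRU.exists_isMixingTime_of_minorized
    (KLRU.transition_mem_rowStochastic hp hsum) hq0 hz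
  have hceil : (⌈1 / q⌉₊ : ℝ) ≤ 2 / q := by
    have h1 := (Nat.ceil_lt_add_one (one_div_pos.2 hq0).le).le
    have h2 : 1 ≤ 1 / q := (one_le_div hq0).2 hq1
    calc (⌈1 / q⌉₊ : ℝ) ≤ 1 / q + 1 / q := by linarith
      _ = 2 / q := by ring
  have htq : (t : ℝ) ≤ 2 * (k * m) / q := by
    calc (t : ℝ) ≤ ((k * m * ⌈1 / q⌉₊ : ℕ) : ℝ) := by exact_mod_cast htle
      _ = k * m * (⌈1 / q⌉₊ : ℝ) := by push_cast; ring
      _ ≤ k * m * (2 / q) := mul_le_mul_of_nonneg_left hceil hkm0.le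
      _ = 2 * (k * m) / q := by ring
  exact ⟨hs1, π, hπ, huniq, t, ht, htq.trans (hbound _ hs hs1),
    htq.trans (hbound _ le_rfl (hs.trans_lt hs1))⟩
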